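/- Theorem (the $\alpha$-permanent as a combination of immanants). Let $n\ge 0$ be an integer, let $S_n$ be the symmetric group on $\{1,\dots,n\}$ and $\mathcal P_n$ the set of integer partitions of $n$. For $\sigma\in S_n$ let $\#\sigma$ be the number of cycles of $\sigma$ (fixed points included), and for $\lambda\in\mathcal P_n$ let $\#\lambda$ be its number of parts and $\chi_\lambda$ the character of the complex Specht module $S^\lambda$. For $M\in\mathbb C^{n\times n}$ and $\alpha\in\mathbb C$ put $$\operatorname{per}_\alpha M=\sum_{\sigma\in S_n}\alpha^{\#\sigma}\prod_{j=1}^n M_{j,\sigma(j)},\qquad \operatorname{Imm}_\lambda M=\sum_{\sigma\in S_n}\chi_\lambda(\sigma)\prod_{j=1}^n M_{j,\sigma(j)},\qquad c_\lambda(\alpha)=\frac1{n!}\sum_{\sigma\in S_n}\alpha^{\#\sigma}\chi_\lambda(\sigma)$$ (with $0^0=1$). Then $$\operatorname{per}_\alpha M=\sum_{\lambda\in\mathcal P_n}c_\lambda(\alpha)\operatorname{Imm}_\lambda M\qquad\text{for all }\alpha\in\mathbb C,\ M\in\mathbb C^{n\times n}.$$ Moreover, let $X=(\chi_\lambda(\nu))_{\lambda,\nu\in\mathcal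 P_n}$ be the character table of $S_n$, with rows indexed by the characters $\chi_\lambda$ and columns by the conjugacy classes (the class $\nu$ consists of the permutations whose cycle lengths are the parts of $\nu$), and let $A=(\alpha^{\#\nu})_{\nu\in\mathcal P_n}$, a column vector. Then $\det X\neq 0$, and for every $\alpha\in\mathbb C$ the column vector $c=(c_\lambda(\alpha))_{\lambda\in\mathcal P_n}$ is the unique solution of $$A=X^{\mathsf T}c,\qquad\text{that is,}\qquad \alpha^{\#\nu}=\sum_{\lambda\in\mathcal P_n}c_\lambda(\alpha)\,\chi_\lambda(\nu)\quad(\nu\in\mathcal P_n).$$ This solution is $$c=\frac{1}{\det X}\,Y A,$$ where $Y$ is the matrix of signed minors (cofactors) of $X$: for any enumeration of $\mathcal P_n$, used for both rows and columns, $Y_{\lambda\nu}=(-1)^{i(\lambda)+i(\nu)}X^{(\lambda,\nu)}$, where $i(\lambda)$ is the position of $\lambda$ in the enumeration and $X^{(\lambda,\nu)}$ is the determinant of $X$ with row $\lambda$ and column $\nu$ removed. -/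

import Mathlib

open scoped BigOperators Matrix

noncomputable section

namespace AlphaPerm

open Equiv

/-! ### Cycles and cycle types -/

/-- The number `#σ` of cycles of a permutation `σ` of `n` points.  Fixed points are cycles of
length one; `Equiv.Perm.cycleType` only lists the cycles of length at least two. -/
def numCycles {n : ℕ} (σ : Perm (Fin n)) : ℕ :=
  Multiset.card σ.cycleType + Fintype.card (Function.fixedPoints σ)

/-- The integer partition of `n` given by the lengths of all cycles of `σ` (fixed points included);
it labels the conjugacy class of `σ`. -/
def cyclePartition {n : ℕ} (σ : Perm (Fin n)) : n.Partition where
  parts := σ.partition.parts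
  parts_pos := fun h => σ.partition.parts_pos h
  parts_sum := σ.partition.parts_sum.trans (Fintype.card_fin n)

theorem exists_cyclePartition_eq {n : ℕ} (ν : n.Partition) :
    ∃ σ : Perm (Fin n), cyclePartition σ = ν := by
  classical
  have hsplit := Multiset.filter_add_not (fun k => 2 ≤ k) ν.parts
  have hones : ν.parts.filter (fun k => ¬ 2 ≤ k)
      = Multiset.replicate (Multiset.card (ν.parts.filter (fun k => ¬ 2 ≤ k))) 1 := by
    rw [Multiset.eq_replicate_card]
    intro b hb
    have h1 := ν.parts_pos (Multiset.mem_of_mem_filter hb)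
    have h2 := (Multiset.mem_filter.1 hb).2
    omega
  have hsum : (ν.parts.filter (fun k => 2 ≤ k)).sum
      + Multiset.card (ν.parts.filter (fun k => ¬ 2 ≤ k)) = n := by
    have h := congrArg Multiset.sum hsplit
    rw [Multiset.sum_add, hones, Multiset.sum_replicate, ν.parts_sum] at h
    simpa using h
  obtain ⟨σ, hσ⟩ := (Equiv.Perm.exists_with_cycleType_iff (Fin n)
    (m := ν.parts.filter (fun k => 2 ≤ k))).2
      ⟨by rw [Fintype.card_fin]; omega, fun a ha => (Multiset.mem_filter.1 ha).2⟩
  refine ⟨σ, Nat.Partition.ext ?_⟩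
  change σ.partition.parts = ν.parts
  rw [Equiv.Perm.parts_partition, ← Equiv.Perm.sum_cycleType, hσ, Fintype.card_fin]
  have : n - (ν.parts.filter (fun k => 2 ≤ k)).sum
      = Multiset.card (ν.parts.filter (fun k => ¬ 2 ≤ k)) := by omega
  rw [this, ← hones]
  exact hsplit

/-- A representative of the conjugacy class of permutations with cycle lengths `ν`. -/
def classRep {n : ℕ} (ν : n.Partition) : Perm (Fin n) :=
  (exists_cyclePartition_eq ν).choose

theorem cyclePartition_classRep {n : ℕ} (ν : n.Partition) : cyclePartition (classRep ν) = ν :=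
  (exists_cyclePartition_eq ν).choose_spec

/-! ### The `α`-permanent -/

/-- The `α`-permanent `per_α M = ∑_σ α ^ #σ ∏_j M_{j, σ j}`. -/
def alphaPermanent {n : ℕ} (α : ℂ) (M : Matrix (Fin n) (Fin n) ℂ) : ℂ :=
  ∑ σ : Perm (Fin n), α ^ numCycles σ * ∏ j, M j (σ j)

/-! ### Specht modules

The Specht module of `lam` is the left ideal of the group algebra `ℂ[S_n]` generated by the Young
symmetrizer of the standard tableau whose boxes are filled row by row, rows having the parts of
`lam` in decreasing order as their lengths. -/

/-- The parts of an integer partition in decreasing order. -/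
def sortedParts {n : ℕ} (lam : n.Partition) : Composition n where
  blocks := lam.parts.sort (· ≥ ·)
  blocks_pos := fun h => lam.parts_pos ((Multiset.mem_sort (r := (· ≥ ·))).1 h)
  blocks_sum := by
    rw [← Multiset.sum_coe, Multiset.sort_eq, lam.parts_sum]

/-- The row of the canonical tableau of shape `lam` that contains the entry `k`. -/
def tabRow {n : ℕ} (lam : n.Partition) (k : Fin n) : ℕ := (sortedParts lam).index k

/-- The column of the canonical tableau of shape `lam` that contains the entry `k`. -/
def tabCol {n : ℕ} (lam : n.Partition) (k : Fin n) : ℕ := (sortedParts lam).invEmbedding k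

open Classical in
/-- The Young symmetrizer: the sum `∑ p` over the permutations preserving every row, times the
signed sum `∑ sgn(q) q` over the permutations preserving every column. -/
def youngSymmetrizer {n : ℕ} (lam : n.Partition) : MonoidAlgebra ℂ (Perm (Fin n)) :=
  (∑ p : Perm (Fin n) with ∀ k, tabRow lam (p k) = tabRow lam k,
      MonoidAlgebra.single p (1 : ℂ)) *
    (∑ q : Perm (Fin n) with ∀ k, tabCol lam (q k) = tabCol lam k,
      MonoidAlgebra.single q ((Perm.sign q : ℤ) : ℂ))

/-- The Specht module `S^lam = ℂ[S_n] · c_lam` (`Ideal` means left ideal). -/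
def spechtModule {n : ℕ} (lam : n.Partition) : Ideal (MonoidAlgebra ℂ (Perm (Fin n))) :=
  Ideal.span {youngSymmetrizer lam}

/-- The representation of `S_n` on the Specht module, by left multiplication. -/
def spechtRep {n : ℕ} (lam : n.Partition) : Representation ℂ (Perm (Fin n)) (spechtModule lam) :=
  ((Algebra.lsmul ℂ ℂ (spechtModule lam) :
      MonoidAlgebra ℂ (Perm (Fin n)) →ₐ[ℂ] Module.End ℂ (spechtModule lam)) :
      MonoidAlgebra ℂ (Perm (Fin n)) →* Module.End ℂ (spechtModule lam)).comp
    (MonoidAlgebra.of ℂ (Perm (Fin n)))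

/-- The irreducible character `χ_lam` of the symmetric group. -/
def chi {n : ℕ} (lam : n.Partition) (σ : Perm (Fin n)) : ℂ := (spechtRep lam).character σ

/-! ### Immanants, coefficients, and the linear system -/

/-- The immanant `Imm_lam M = ∑_σ χ_lam(σ) ∏_j M_{j, σ j}`. -/
def immanant {n : ℕ} (lam : n.Partition) (M : Matrix (Fin n) (Fin n) ℂ) : ℂ :=
  ∑ σ : Perm (Fin n), chi lam σ * ∏ j, M j (σ j)

/-- `c_lam(α) = (1 / n!) ∑_σ α ^ #σ χ_lam(σ)`. -/
def coeff {n : ℕ} (lam : n.Partition) (α : ℂ) : ℂ :=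
  (1 / (n.factorial : ℂ)) * ∑ σ : Perm (Fin n), α ^ numCycles σ * chi lam σ

/-- The character table: the `(lam, ν)` entry is the value of `χ_lam` on the class `ν`. -/
def charTable (n : ℕ) : Matrix n.Partition n.Partition ℂ :=
  Matrix.of fun lam ν => chi lam (classRep ν)

/-- The entries of the character table do not depend on the choice of representatives. -/
theorem charTable_cyclePartition {n : ℕ} (lam : n.Partition) (σ : Perm (Fin n)) :
    charTable n lam (cyclePartition σ) = chi lam σ := by
  have h : (classRep (cyclePartition σ)).partition = σ.partition := by
    apply Nat.Partition.ext
    change (cyclePartition (classRep (cyclePartition σ))).parts = (cyclePartition σ).parts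
    rw [cyclePartition_classRep]
  obtain ⟨g, hg⟩ := isConj_iff.1 (Perm.partition_eq_of_isConj.2 h)
  have hc := Representation.char_conj (spechtRep lam) (classRep (cyclePartition σ)) g
  rw [hg] at hc
  exact hc.symm

/-- The column vector `A = (α ^ #lam)`, with `#lam` the number of parts of `lam`. -/
def powVec (n : ℕ) (α : ℂ) : n.Partition → ℂ := fun lam => α ^ Multiset.card lam.parts

/-- The minor determinant of `B` with row `i` and column `j` removed, where the index set is
enumerated by `e`. -/
def minorDet {ι : Type*} {m : ℕ} (e : ι ≃ Fin (m + 1)) (B : Matrix ι ι ℂ) (i j : ι) : ℂ :=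
  ((B.reindex e e).submatrix (e i).succAbove (e j).succAbove).det

/-- The matrix of signed minor determinants (cofactors) of `B`. -/
def minorMatrix {ι : Type*} {m : ℕ} (e : ι ≃ Fin (m + 1)) (B : Matrix ι ι ℂ) : Matrix ι ι ℂ :=
  Matrix.of fun i j => (-1) ^ ((e i : ℕ) + (e j : ℕ)) * minorDet e B i j

end AlphaPerm

end

noncomputable section

namespace AlphaPerm

open Equiv

/-! ### Counting boxes of Young diagrams -/

/-! Everything follows from orthonormality of the Specht characters. With `X` the character table
and `D` the diagonal matrix of class densities, it reads `X D Xᵀ = 1`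
(`charTable_mul_classDensity_mul_transpose`), so `det X ≠ 0` and `Xᵀ X D = 1`. Grouping the sum
defining `coeff` by classes gives `c = X D A`, hence `Xᵀ c = A`; inserting this into the α-permanent
gives the immanant expansion, and the adjugate gives the cofactor formula.

Orthonormality (`chi_orthonormal`): the inner product of two characters is the dimension of the
space of intertwiners. Evaluation at the generator embeds this space into `c_lam ℂ[S_n] c_mu`, where
`c_lam` is the Young symmetrizer. That space is the line through `c_lam` if `lam = mu`, and is zero
unless the column counts of `lam` are bounded by those of `mu`. This relation is antisymmetric, so
for distinct partitions one of the two directions vanishes, and the inner product is symmetric. -/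

theorem tab_injective {n : ℕ} (lam : n.Partition) {i j : Fin n}
    (hr : tabRow lam i = tabRow lam j) (hc : tabCol lam i = tabCol lam j) : i = j := by
  have hi := (sortedParts lam).coe_invEmbedding i
  have hj := (sortedParts lam).coe_invEmbedding j
  have hi' := (sortedParts lam).sizeUpTo_index_le i
  have hj' := (sortedParts lam).sizeUpTo_index_le j
  unfold tabRow at hr
  unfold tabCol at hc
  rw [hr] at hi hi'
  apply Fin.ext
  omega

/-- The number of boxes in the first `m` columns of the Young diagram of `lam`. -/
def boxesUpToCol {n : ℕ} (lam : n.Partition) (m : ℕ) : ℕ :=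
  ∑ r, min ((sortedParts lam).blocksFun r) m

theorem boxesUpToCol_eq {n : ℕ} (lam : n.Partition) (m : ℕ) :
    boxesUpToCol lam m = (lam.parts.map fun k => min k m).sum := by
  have h : lam.parts = (List.ofFn (sortedParts lam).blocksFun : Multiset ℕ) := by
    rw [Composition.ofFn_blocksFun]
    exact (Multiset.sort_eq _ _).symm
  rw [h, boxesUpToCol, Multiset.map_coe, Multiset.sum_coe, List.map_ofFn, List.sum_ofFn]
  rfl

theorem card_row_col_lt {n : ℕ} (lam : n.Partition) (r : Fin (sortedParts lam).length) (m : ℕ) :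
    (Finset.univ.filter fun i => (sortedParts lam).index i = r ∧ tabCol lam i < m).card
      = min ((sortedParts lam).blocksFun r) m := by
  have h : (Finset.univ.filter fun i => (sortedParts lam).index i = r ∧ tabCol lam i < m)
      = (Finset.univ.filter fun x : Fin ((sortedParts lam).blocksFun r) => (x : ℕ) < m).map
        ((sortedParts lam).embedding r).toEmbedding := by
    ext i
    simp only [Finset.mem_filter, Finset.mem_univ, true_and, Finset.mem_map]
    constructor
    · rintro ⟨rfl, h⟩
      exact ⟨_, h, (sortedParts lam).embedding_comp_inv i⟩
    · rintro ⟨x, hx, rfl⟩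
      have := (sortedParts lam).index_embedding r x
      refine ⟨this, ?_⟩
      have h2 := (sortedParts lam).invEmbedding_comp r x
      unfold tabCol
      change ((((sortedParts lam).invEmbedding ((sortedParts lam).embedding r x)) : ℕ)) < m
      rwa [h2]
  rw [h, Finset.card_map, Fin.card_filter_val_lt]

theorem card_row {n : ℕ} (lam : n.Partition) (r : Fin (sortedParts lam).length) :
    (Finset.univ.filter fun i => (sortedParts lam).index i = r).card
      = (sortedParts lam).blocksFun r := by
  -- All column indices are below `n`, so `m = n` makes the column condition vacuous.
  have h := card_row_col_lt lam r n
  rw [min_eq_left ((sortedParts lam).blocksFun_le r)] at h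
  rw [← h]
  congr 1
  ext i
  have : tabCol lam i < n := lt_of_lt_of_le (Fin.is_lt _) ((sortedParts lam).blocksFun_le _)
  simp [this]

theorem card_eq_sum_rows {n : ℕ} (lam : n.Partition) (P : Fin n → Prop) [DecidablePred P] :
    (Finset.univ.filter P).card
      = ∑ r, (Finset.univ.filter fun i => (sortedParts lam).index i = r ∧ P i).card := by
  rw [Finset.card_eq_sum_card_fiberwise (f := (sortedParts lam).index) (t := Finset.univ)
    (fun _ _ => Finset.mem_coe.2 (Finset.mem_univ _))]
  simp_rw [Finset.filter_filter, and_comm]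

theorem card_col_lt {n : ℕ} (lam : n.Partition) (m : ℕ) :
    (Finset.univ.filter fun i => tabCol lam i < m).card = boxesUpToCol lam m := by
  rw [card_eq_sum_rows lam]
  simp_rw [card_row_col_lt]
  rfl

theorem card_row_lt_le {n : ℕ} (mu : n.Partition) (f : Fin n → ℕ)
    (hf : ∀ i j, tabRow mu i = tabRow mu j → f i = f j → i = j)
    (r : Fin (sortedParts mu).length) (m : ℕ) :
    (Finset.univ.filter fun i => (sortedParts mu).index i = r ∧ f i < m).card
      ≤ min ((sortedParts mu).blocksFun r) m := by
  refine le_min ?_ ?_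
  · rw [← card_row mu r]
    exact Finset.card_le_card fun i => by simp +contextual
  · have h := Finset.card_le_card_of_injOn (t := Finset.range m) f
      (s := Finset.univ.filter fun i => (sortedParts mu).index i = r ∧ f i < m)
      (fun i hi => by simpa using (Finset.mem_filter.1 hi).2.2)
      (fun i hi j hj hij => hf i j (by
        rw [tabRow, tabRow, (Finset.mem_filter.1 hi).2.1, (Finset.mem_filter.1 hj).2.1]) hij)
    simpa using h

theorem card_col_comp_perm_lt {n : ℕ} (lam : n.Partition) (h : Perm (Fin n)) (m : ℕ) :
    (Finset.univ.filter fun i => tabCol lam (h i) < m).card = boxesUpToCol lam m := by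
  rw [← card_col_lt]
  exact Finset.card_equiv h (by simp)

/-- Dominance by columns: the entries that `h` sends to the first `m` columns of `lam` are counted
along the rows of `mu`, each of which holds at most `m` of them. -/
theorem boxesUpToCol_le {n : ℕ} (lam mu : n.Partition) (h : Perm (Fin n))
    (hf : ∀ i j, tabRow mu i = tabRow mu j → tabCol lam (h i) = tabCol lam (h j) → i = j) (m : ℕ) :
    boxesUpToCol lam m ≤ boxesUpToCol mu m := by
  rw [← card_col_comp_perm_lt lam h, card_eq_sum_rows mu]
  exact Finset.sum_le_sum fun r _ => card_row_lt_le mu _ hf r m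

/-- Equality case of the dominance count: the totals agree, so every row bound is sharp. Taking `m`
to be the length of the row of `i`, the whole row is counted. -/
theorem col_lt_of_injective_on_rows {n : ℕ} (lam : n.Partition) (h : Perm (Fin n))
    (hf : ∀ i j, tabRow lam i = tabRow lam j → tabCol lam (h i) = tabCol lam (h j) → i = j)
    (i : Fin n) :
    tabCol lam (h i) < (sortedParts lam).blocksFun ((sortedParts lam).index i) := by
  set r := (sortedParts lam).index i with hr
  set m := (sortedParts lam).blocksFun r
  have hsum := card_col_comp_perm_lt lam h m
  rw [card_eq_sum_rows lam] at hsum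
  have heq := (Finset.sum_eq_sum_iff_of_le
    (fun r _ => card_row_lt_le lam (fun i => tabCol lam (h i)) hf r m)).1 hsum r (Finset.mem_univ _)
  rw [min_self, ← card_row lam r] at heq
  have hsub := Finset.eq_of_subset_of_card_le
    (s := Finset.univ.filter fun i => (sortedParts lam).index i = r ∧ tabCol lam (h i) < m)
    (t := Finset.univ.filter fun i => (sortedParts lam).index i = r)
    (fun i => by simp +contextual) heq.ge
  have : i ∈ Finset.univ.filter fun i => (sortedParts lam).index i = r := by simp [hr]
  rw [← hsub] at this
  exact (Finset.mem_filter.1 this).2.2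

/-- A permutation taking no two entries of a row of the canonical tableau into one column is a
column permutation after a row permutation. -/
theorem exists_row_col_factorization {n : ℕ} (lam : n.Partition) (h : Perm (Fin n))
    (hf : ∀ i j, tabRow lam i = tabRow lam j → tabCol lam (h i) = tabCol lam (h j) → i = j) :
    ∃ u : Perm (Fin n), (∀ i, tabRow lam (u i) = tabRow lam i) ∧
      ∀ i, tabCol lam (u i) = tabCol lam (h i) := by
  -- Each `i` moves inside its row to the column of `h i`; the preceding bound says that this box
  -- exists.
  let u : Fin n → Fin n := fun i =>
    (sortedParts lam).embedding ((sortedParts lam).index i)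
      ⟨tabCol lam (h i), col_lt_of_injective_on_rows lam h hf i⟩
  have hrow : ∀ i, tabRow lam (u i) = tabRow lam i := fun i => by
    unfold tabRow
    exact congrArg Fin.val ((sortedParts lam).index_embedding _ _)
  have hcol : ∀ i, tabCol lam (u i) = tabCol lam (h i) := fun i =>
    (sortedParts lam).invEmbedding_comp _ _
  have hinj : Function.Injective u := fun i j hij =>
    hf i j (by rw [← hrow i, ← hrow j, hij]) (by rw [← hcol i, ← hcol j, hij])
  exact ⟨Equiv.ofBijective u (Finite.injective_iff_bijective.1 hinj), hrow, hcol⟩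

theorem sum_map_min_succ (s : Multiset ℕ) (m : ℕ) :
    (s.map fun k => min k (m + 1)).sum
      = (s.map fun k => min k m).sum + s.countP (fun k => m < k) := by
  induction s using Multiset.induction_on with
  | empty => simp
  | cons a s ih =>
    simp only [Multiset.map_cons, Multiset.sum_cons, ih, Multiset.countP_cons]
    split_ifs <;> omega

theorem countP_lt_eq (s : Multiset ℕ) (m : ℕ) :
    s.countP (fun k => m < k) = s.countP (fun k => m + 1 < k) + s.count (m + 1) := by
  induction s using Multiset.induction_on with
  | empty => simp
  | cons a s ih =>
    simp only [ih, Multiset.countP_cons, Multiset.count_cons]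
    split_ifs <;> omega

/-- First differences in `m` count the parts exceeding `m`; second differences recover the
multiplicity of the part `m + 1`. -/
theorem eq_of_boxesUpToCol_eq {n : ℕ} {lam mu : n.Partition}
    (h : ∀ m, boxesUpToCol lam m = boxesUpToCol mu m) : lam = mu := by
  simp_rw [boxesUpToCol_eq] at h
  have hP : ∀ m, lam.parts.countP (fun k => m < k) = mu.parts.countP (fun k => m < k) := fun m => by
    have h1 := sum_map_min_succ lam.parts m
    have h2 := sum_map_min_succ mu.parts m
    have h3 := h m
    have h4 := h (m + 1)
    omega
  apply Nat.Partition.ext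
  ext k
  cases k with
  | zero =>
    rw [Multiset.count_eq_zero_of_notMem fun h0 => (lam.parts_pos h0).ne rfl,
      Multiset.count_eq_zero_of_notMem fun h0 => (mu.parts_pos h0).ne rfl]
  | succ m =>
    have h1 := countP_lt_eq lam.parts m
    have h2 := countP_lt_eq mu.parts m
    have h3 := hP m
    have h4 := hP (m + 1)
    omega

/-! ### Young symmetrizers -/

/-- The sign character with complex values. -/
def signHom (n : ℕ) : Perm (Fin n) →* ℂ :=
  (Int.castRingHom ℂ : ℤ →* ℂ).comp ((Units.coeHom ℤ).comp Perm.sign)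

open Classical in
/-- The sum of the permutations preserving `f`, weighted by the linear character `ε`. -/
def stabSum {n : ℕ} (f : Fin n → ℕ) (ε : Perm (Fin n) →* ℂ) : MonoidAlgebra ℂ (Perm (Fin n)) :=
  ∑ p : Perm (Fin n) with ∀ k, f (p k) = f k, MonoidAlgebra.single p (ε p)

theorem youngSymmetrizer_eq {n : ℕ} (lam : n.Partition) :
    youngSymmetrizer lam = stabSum (tabRow lam) 1 * stabSum (tabCol lam) (signHom n) := rfl

theorem single_mul_stabSum {n : ℕ} (f : Fin n → ℕ) (ε : Perm (Fin n) →* ℂ) {q : Perm (Fin n)}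
    (hq : ∀ k, f (q k) = f k) : MonoidAlgebra.single q (ε q) * stabSum f ε = stabSum f ε := by
  unfold stabSum
  rw [Finset.mul_sum]
  refine Finset.sum_equiv (Equiv.mulLeft q) (fun p => ?_) (fun p _ => ?_)
  · simp [hq]
  · simp [MonoidAlgebra.single_mul_single]

theorem stabSum_mul_single {n : ℕ} (f : Fin n → ℕ) (ε : Perm (Fin n) →* ℂ) {q : Perm (Fin n)}
    (hq : ∀ k, f (q k) = f k) : stabSum f ε * MonoidAlgebra.single q (ε q) = stabSum f ε := by
  unfold stabSum
  rw [Finset.sum_mul]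
  refine Finset.sum_equiv (Equiv.mulRight q) (fun p => ?_) (fun p _ => ?_)
  · simp only [Finset.mem_filter, Finset.mem_univ, true_and, Equiv.coe_mulRight, Perm.mul_apply]
    constructor
    · intro h k
      rw [h, hq]
    · intro h k
      have := h (q⁻¹ k)
      have h2 := hq (q⁻¹ k)
      simp only [← Perm.mul_apply, mul_inv_cancel, Perm.one_apply] at this h2
      rw [this, h2]
  · simp [MonoidAlgebra.single_mul_single]

theorem comp_swap_eq {n : ℕ} (f : Fin n → ℕ) {i j : Fin n} (h : f i = f j) (k : Fin n) :
    f (swap i j k) = f k := by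
  rcases eq_or_ne k i with rfl | hi
  · simp [h]
  rcases eq_or_ne k j with rfl | hj
  · simp [h]
  rw [swap_apply_of_ne_of_ne hi hj]

theorem signHom_swap {n : ℕ} {i j : Fin n} (h : i ≠ j) : signHom n (swap i j) = -1 := by
  simp [signHom, Perm.sign_swap h]

theorem single_neg_one_eq {n : ℕ} (g : Perm (Fin n)) :
    MonoidAlgebra.single g (-1 : ℂ) = -MonoidAlgebra.single g 1 := by
  rw [MonoidAlgebra.single_neg]

theorem eq_zero_of_eq_neg {V : Type*} [AddCommGroup V] [Module ℂ V] {x : V} (h : x = -x) :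
    x = 0 := by
  have h2 : (2 : ℂ) • x = 0 := by
    rw [two_smul]
    exact add_eq_zero_iff_eq_neg.2 h
  exact (smul_eq_zero.1 h2).resolve_left two_ne_zero

/-- A transposition fixing `a` on the right and, after conjugation by `g`, negating `b`, makes
`a g b` vanish. -/
theorem row_mul_single_mul_col_eq_zero {n : ℕ} (f f' : Fin n → ℕ) (g : Perm (Fin n)) {i j : Fin n}
    (hij : i ≠ j) (hr : f i = f j) (hc : f' (g⁻¹ i) = f' (g⁻¹ j)) :
    stabSum f 1 * MonoidAlgebra.single g 1 * stabSum f' (signHom n) = 0 := by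
  have h1 := stabSum_mul_single f 1 (comp_swap_eq f hr)
  have h2 := single_mul_stabSum f' (signHom n) (comp_swap_eq f' hc)
  rw [signHom_swap (g⁻¹.injective.ne hij), single_neg_one_eq, neg_mul] at h2
  rw [MonoidHom.one_apply] at h1
  have h3 : MonoidAlgebra.single (swap i j) (1 : ℂ) * MonoidAlgebra.single g 1
      = MonoidAlgebra.single g 1 * MonoidAlgebra.single (swap (g⁻¹ i) (g⁻¹ j)) 1 := by
    rw [MonoidAlgebra.single_mul_single, MonoidAlgebra.single_mul_single, swap_mul_eq_mul_swap]
  -- The row sum emits a transposition, which passes through `g` and is absorbed by the column sum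
  -- with sign `-1`.
  have h4 : stabSum f 1 * MonoidAlgebra.single g 1 * stabSum f' (signHom n)
      = -(stabSum f 1 * MonoidAlgebra.single g 1 * stabSum f' (signHom n)) := by
    conv_lhs => rw [← h1, mul_assoc (stabSum f 1), h3]
    conv_rhs => rw [← h2]
    simp only [mul_assoc, mul_neg, neg_neg]
  exact eq_zero_of_eq_neg h4

theorem col_mul_single_mul_row_eq_zero {n : ℕ} (f f' : Fin n → ℕ) (g : Perm (Fin n)) {i j : Fin n}
    (hij : i ≠ j) (hr : f i = f j) (hc : f' (g i) = f' (g j)) :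
    stabSum f' (signHom n) * MonoidAlgebra.single g 1 * stabSum f 1 = 0 := by
  have h1 := single_mul_stabSum f 1 (comp_swap_eq f hr)
  have h2 := stabSum_mul_single f' (signHom n) (comp_swap_eq f' hc)
  rw [signHom_swap (g.injective.ne hij), single_neg_one_eq, mul_neg] at h2
  rw [MonoidHom.one_apply] at h1
  have h3 : MonoidAlgebra.single g (1 : ℂ) * MonoidAlgebra.single (swap i j) 1
      = MonoidAlgebra.single (swap (g i) (g j)) 1 * MonoidAlgebra.single g 1 := by
    rw [MonoidAlgebra.single_mul_single, MonoidAlgebra.single_mul_single, mul_swap_eq_swap_mul]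
  have h4 : stabSum f' (signHom n) * MonoidAlgebra.single g 1 * stabSum f 1
      = -(stabSum f' (signHom n) * MonoidAlgebra.single g 1 * stabSum f 1) := by
    conv_lhs => rw [← h1, ← mul_assoc, mul_assoc (stabSum f' (signHom n)), h3]
    conv_rhs => rw [← h2]
    simp only [mul_assoc, neg_mul, neg_neg]
  exact eq_zero_of_eq_neg h4

/-- `x ↦ a x b` has values in a submodule as soon as its values at group elements are there. -/
theorem mul_mul_mem {n : ℕ} (a b : MonoidAlgebra ℂ (Perm (Fin n)))
    (S : Submodule ℂ (MonoidAlgebra ℂ (Perm (Fin n))))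
    (h : ∀ g, a * MonoidAlgebra.single g 1 * b ∈ S) (x : MonoidAlgebra ℂ (Perm (Fin n))) :
    a * x * b ∈ S := by
  induction x using MonoidAlgebra.induction_on with
  | of g => exact h g
  | add x y hx hy => rw [mul_add, add_mul]; exact S.add_mem hx hy
  | smul r x hx => rw [mul_smul_comm, smul_mul_assoc]; exact S.smul_mem r hx

/-- Row and column stabilizers meet only in the identity, so `p * q = 1` forces `p = q = 1`. -/
theorem coeff_youngSymmetrizer {n : ℕ} (lam : n.Partition) :
    (youngSymmetrizer lam).coeff 1 = 1 := by
  classical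
  rw [youngSymmetrizer_eq, stabSum, stabSum, Finset.sum_mul_sum]
  simp only [MonoidAlgebra.single_mul_single, MonoidAlgebra.coeff_sum, Finsupp.finsetSum_apply,
    MonoidAlgebra.coeff_single, MonoidHom.one_apply, one_mul, Finsupp.single_apply]
  rw [Finset.sum_eq_single 1, Finset.sum_eq_single 1]
  · simp
  · intro q _ hq
    simp [hq]
  · simp
  · intro p hp hp1
    refine Finset.sum_eq_zero fun q hq => if_neg fun hpq => hp1 ?_
    simp only [Finset.mem_filter, Finset.mem_univ, true_and] at hp hq
    obtain rfl : q = p⁻¹ := (inv_eq_of_mul_eq_one_right hpq).symm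
    ext1 k
    refine tab_injective lam (hp k) ?_
    have := hq (p k)
    simpa using this.symm
  · simp

/-- Right multiplication by `c` is nilpotent, hence of trace zero, while each of its diagonal
entries in the group basis equals `c.coeff 1`. -/
theorem coeff_one_eq_zero_of_mul_self_eq_zero {G : Type*} [Group G] [Fintype G]
    {c : MonoidAlgebra ℂ G} (h : c * c = 0) : c.coeff 1 = 0 := by
  classical
  have hnil : IsNilpotent (LinearMap.mulRight ℂ c) := ⟨2, LinearMap.ext fun x => by
    simp [pow_two, mul_assoc, h]⟩
  have h0 := (LinearMap.isNilpotent_trace_of_isNilpotent hnil).eq_zero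
  let B : Module.Basis G ℂ (MonoidAlgebra ℂ G) := ⟨MonoidAlgebra.coeffLinearEquiv ℂ⟩
  rw [LinearMap.trace_eq_matrix_trace ℂ B, Matrix.trace] at h0
  have hB : ∀ g, B g = MonoidAlgebra.single g 1 := fun g => rfl
  have hd : ∀ g, LinearMap.toMatrix B B (LinearMap.mulRight ℂ c) g g = c.coeff 1 := fun g => by
    rw [LinearMap.toMatrix_apply, hB, LinearMap.mulRight_apply]
    change (MonoidAlgebra.single g 1 * c).coeff g = _
    rw [MonoidAlgebra.coeff_single_mul_apply]
    simp
  simpa [Matrix.diag, hd] using h0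

theorem youngSymmetrizer_ne_zero {n : ℕ} (lam : n.Partition) : youngSymmetrizer lam ≠ 0 :=
  fun h => by simpa [h] using coeff_youngSymmetrizer lam

/-- A group element `g` either factors as a row permutation times a column permutation, which the
two sums absorb up to sign, or two entries of one row give a transposition that kills the product.
-/
theorem row_mul_mul_col_mem_span {n : ℕ} (lam : n.Partition)
    (x : MonoidAlgebra ℂ (Perm (Fin n))) :
    stabSum (tabRow lam) 1 * x * stabSum (tabCol lam) (signHom n)
      ∈ Submodule.span ℂ {youngSymmetrizer lam} := by
  refine mul_mul_mem _ _ _ (fun g => ?_) x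
  by_cases hg : ∀ i j, tabRow lam i = tabRow lam j →
      tabCol lam (g⁻¹ i) = tabCol lam (g⁻¹ j) → i = j
  · obtain ⟨u, hrow, hcol⟩ := exists_row_col_factorization lam g⁻¹ hg
    have hrow' : ∀ k, tabRow lam (u⁻¹ k) = tabRow lam k := fun k => by
      simpa using (hrow (u⁻¹ k)).symm
    have hcol' : ∀ k, tabCol lam ((u * g) k) = tabCol lam k := fun k => by
      simpa using hcol (g k)
    have h1 := stabSum_mul_single (tabRow lam) 1 hrow'
    have h2 := single_mul_stabSum (tabCol lam) (signHom n) hcol'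
    rw [MonoidHom.one_apply] at h1
    have hs : signHom n (u * g) * signHom n (u * g)⁻¹ = 1 := by rw [← map_mul]; simp
    have h3 : MonoidAlgebra.single (u * g) (1 : ℂ) * stabSum (tabCol lam) (signHom n)
        = signHom n (u * g)⁻¹ • stabSum (tabCol lam) (signHom n) := by
      conv_rhs => rw [← h2, ← smul_mul_assoc, MonoidAlgebra.smul_single, smul_eq_mul,
        mul_comm (signHom n _), hs]
    have hgm : MonoidAlgebra.single g (1 : ℂ)
        = MonoidAlgebra.single u⁻¹ 1 * MonoidAlgebra.single (u * g) 1 := by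
      simp [MonoidAlgebra.single_mul_single]
    rw [hgm, ← mul_assoc, h1, mul_assoc, h3, mul_smul_comm, ← youngSymmetrizer_eq]
    exact Submodule.smul_mem _ _ (Submodule.mem_span_singleton_self _)
  · push Not at hg
    obtain ⟨i, j, hr, hc, hij⟩ := hg
    rw [row_mul_single_mul_col_eq_zero _ _ g hij hr hc]
    exact Submodule.zero_mem _

theorem youngSymmetrizer_mul_mul_mem_span {n : ℕ} (lam : n.Partition)
    (x : MonoidAlgebra ℂ (Perm (Fin n))) :
    youngSymmetrizer lam * x * youngSymmetrizer lam
      ∈ Submodule.span ℂ {youngSymmetrizer lam} := by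
  have h := row_mul_mul_col_mem_span lam
    (stabSum (tabCol lam) (signHom n) * x * stabSum (tabRow lam) 1)
  simpa only [youngSymmetrizer_eq, mul_assoc] using h

/-- A Young symmetrizer is a nonzero multiple of an idempotent. -/
theorem youngSymmetrizer_mul_self {n : ℕ} (lam : n.Partition) :
    ∃ k : ℂ, k ≠ 0 ∧ youngSymmetrizer lam * youngSymmetrizer lam = k • youngSymmetrizer lam := by
  have h := youngSymmetrizer_mul_mul_mem_span lam 1
  rw [mul_one] at h
  obtain ⟨k, hk⟩ := Submodule.mem_span_singleton.1 h
  refine ⟨k, ?_, hk.symm⟩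
  rintro rfl
  rw [zero_smul] at hk
  have h1 := coeff_one_eq_zero_of_mul_self_eq_zero hk.symm
  rw [coeff_youngSymmetrizer] at h1
  exact one_ne_zero h1

/-- The inner factor (columns of `lam`, then `x`, then rows of `mu`) already vanishes: a group
element with nonzero contribution would satisfy the hypothesis of `boxesUpToCol_le`. -/
theorem youngSymmetrizer_mul_mul_eq_zero {n : ℕ} {lam mu : n.Partition}
    (hlt : ¬ ∀ m, boxesUpToCol lam m ≤ boxesUpToCol mu m)
    (x : MonoidAlgebra ℂ (Perm (Fin n))) :
    youngSymmetrizer lam * x * youngSymmetrizer mu = 0 := by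
  have h : stabSum (tabCol lam) (signHom n) * x * stabSum (tabRow mu) 1
      ∈ (⊥ : Submodule ℂ (MonoidAlgebra ℂ (Perm (Fin n)))) := by
    refine mul_mul_mem _ _ _ (fun g => ?_) x
    rw [Submodule.mem_bot]
    by_contra hne
    refine hlt (boxesUpToCol_le lam mu g fun i j hr hc => ?_)
    by_contra hij
    exact hne (col_mul_single_mul_row_eq_zero _ _ g hij hr hc)
  rw [Submodule.mem_bot] at h
  have h2 : youngSymmetrizer lam * x * youngSymmetrizer mu = stabSum (tabRow lam) 1 *
      (stabSum (tabCol lam) (signHom n) * x * stabSum (tabRow mu) 1) *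
        stabSum (tabCol mu) (signHom n) := by
    simp only [youngSymmetrizer_eq, mul_assoc]
  rw [h2, h, mul_zero, zero_mul]

/-! ### Homomorphisms between Specht modules -/

instance finiteDimensional_spechtModule {n : ℕ} (lam : n.Partition) :
    FiniteDimensional ℂ (spechtModule lam) :=
  FiniteDimensional.of_injective ((spechtModule lam).subtype.restrictScalars ℂ)
    Subtype.val_injective

/-- The Young symmetrizer as an element of the Specht module. -/
def spechtGen {n : ℕ} (lam : n.Partition) : spechtModule lam :=
  ⟨youngSymmetrizer lam, Ideal.subset_span rfl⟩

theorem intertwiningMap_smul {n : ℕ} {lam mu : n.Partition}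
    (φ : (spechtRep lam).IntertwiningMap (spechtRep mu))
    (x : MonoidAlgebra ℂ (Perm (Fin n))) (v : spechtModule lam) : φ (x • v) = x • φ v := by
  induction x using MonoidAlgebra.induction_on with
  | of g => exact Representation.IntertwiningMap.isIntertwining _ _ φ g v
  | add x y hx hy => rw [add_smul, map_add, hx, hy, add_smul]
  | smul r x hx => rw [smul_assoc, map_smul, hx, smul_assoc]

/-- Evaluation of an intertwining map at the generator. -/
def evalGen {n : ℕ} (lam mu : n.Partition) :
    (spechtRep lam).IntertwiningMap (spechtRep mu) →ₗ[ℂ] MonoidAlgebra ℂ (Perm (Fin n)) where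
  toFun φ := φ (spechtGen lam)
  map_add' _ _ := rfl
  map_smul' _ _ := rfl

theorem evalGen_injective {n : ℕ} (lam mu : n.Partition) :
    Function.Injective (evalGen lam mu) := by
  intro φ ψ h
  have h' : φ (spechtGen lam) = ψ (spechtGen lam) := Subtype.ext h
  apply Representation.IntertwiningMap.ext
  ext1 v
  obtain ⟨x, hx⟩ := Ideal.mem_span_singleton'.1 v.2
  obtain rfl : x • spechtGen lam = v := Subtype.ext hx
  change φ _ = ψ _
  rw [intertwiningMap_smul, intertwiningMap_smul, h']

/-- The symmetrizer scales its own generator by `k ≠ 0`, so it also scales the image of the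
generator by `k`; dividing by `k` exhibits the left factor. -/
theorem evalGen_eq {n : ℕ} {lam mu : n.Partition}
    (φ : (spechtRep lam).IntertwiningMap (spechtRep mu)) :
    ∃ (r : ℂ) (x : MonoidAlgebra ℂ (Perm (Fin n))),
      evalGen lam mu φ = r • (youngSymmetrizer lam * x * youngSymmetrizer mu) := by
  obtain ⟨k, hk, hsq⟩ := youngSymmetrizer_mul_self lam
  obtain ⟨x, hx⟩ := Ideal.mem_span_singleton'.1 (φ (spechtGen lam)).2
  refine ⟨k⁻¹, x, ?_⟩
  have h1 : youngSymmetrizer lam • spechtGen lam = k • spechtGen lam := Subtype.ext hsq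
  have h2 := intertwiningMap_smul φ (youngSymmetrizer lam) (spechtGen lam)
  rw [h1, map_smul] at h2
  have h3 : k • evalGen lam mu φ = youngSymmetrizer lam * evalGen lam mu φ :=
    congrArg Subtype.val h2
  have h4 : x * youngSymmetrizer mu = evalGen lam mu φ := hx
  rw [mul_assoc, h4, ← h3, inv_smul_smul₀ hk]

theorem finrank_intertwiningMap_self {n : ℕ} (lam : n.Partition) :
    Module.finrank ℂ ((spechtRep lam).IntertwiningMap (spechtRep lam)) = 1 := by
  have hle : LinearMap.range (evalGen lam lam) ≤ Submodule.span ℂ {youngSymmetrizer lam} := by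
    rintro _ ⟨φ, rfl⟩
    obtain ⟨r, x, h⟩ := evalGen_eq φ
    rw [h]
    exact Submodule.smul_mem _ _ (youngSymmetrizer_mul_mul_mem_span lam x)
  have hge : Submodule.span ℂ {youngSymmetrizer lam} ≤ LinearMap.range (evalGen lam lam) := by
    rw [Submodule.span_singleton_le_iff_mem]
    exact ⟨Representation.IntertwiningMap.id _, rfl⟩
  rw [← LinearMap.finrank_range_of_inj (evalGen_injective lam lam), le_antisymm hle hge,
    finrank_span_singleton (youngSymmetrizer_ne_zero lam)]

theorem finrank_intertwiningMap_eq_zero {n : ℕ} {lam mu : n.Partition}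
    (hlt : ¬ ∀ m, boxesUpToCol lam m ≤ boxesUpToCol mu m) :
    Module.finrank ℂ ((spechtRep lam).IntertwiningMap (spechtRep mu)) = 0 := by
  have h0 : ∀ φ, evalGen lam mu φ = 0 := fun φ => by
    obtain ⟨r, x, h⟩ := evalGen_eq φ
    rw [h, youngSymmetrizer_mul_mul_eq_zero hlt, smul_zero]
  have : Subsingleton ((spechtRep lam).IntertwiningMap (spechtRep mu)) :=
    ⟨fun φ ψ => evalGen_injective lam mu ((h0 φ).trans (h0 ψ).symm)⟩
  exact Module.finrank_zero_of_subsingleton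

/-! ### Orthogonality of characters -/

theorem cyclePartition_inv {n : ℕ} (σ : Perm (Fin n)) :
    cyclePartition σ⁻¹ = cyclePartition σ := by
  apply Nat.Partition.ext
  change σ⁻¹.partition.parts = σ.partition.parts
  rw [Perm.parts_partition, Perm.parts_partition, Perm.cycleType_inv, Perm.support_inv]

/-- A permutation and its inverse have the same cycle type; this removes the inverse from the
orthogonality relation. -/
theorem chi_inv {n : ℕ} (lam : n.Partition) (σ : Perm (Fin n)) : chi lam σ⁻¹ = chi lam σ := by
  rw [← charTable_cyclePartition, cyclePartition_inv, charTable_cyclePartition]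

theorem sum_chi_mul_chi_eq_finrank {n : ℕ} (lam mu : n.Partition) :
    ((n.factorial : ℂ))⁻¹ * ∑ σ : Perm (Fin n), chi lam σ * chi mu σ
      = Module.finrank ℂ ((spechtRep lam).IntertwiningMap (spechtRep mu)) := by
  have hcard : Nat.card (Perm (Fin n)) = n.factorial := by
    rw [Nat.card_eq_fintype_card, Fintype.card_perm, Fintype.card_fin]
  let _ : Invertible (Nat.card (Perm (Fin n)) : ℂ) :=
    invertibleOfNonzero (Nat.cast_ne_zero.2 Nat.card_pos.ne')
  rw [← Representation.card_inv_mul_sum_char_mul_char_eq_finrank (spechtRep lam) (spechtRep mu),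
    hcard]
  refine congrArg _ (Finset.sum_congr rfl fun σ _ => ?_)
  change _ = chi mu σ * chi lam σ⁻¹
  rw [chi_inv, mul_comm]

theorem chi_orthonormal {n : ℕ} (lam mu : n.Partition) :
    ((n.factorial : ℂ))⁻¹ * ∑ σ : Perm (Fin n), chi lam σ * chi mu σ
      = if lam = mu then 1 else 0 := by
  split_ifs with h
  · subst h
    rw [sum_chi_mul_chi_eq_finrank, finrank_intertwiningMap_self, Nat.cast_one]
  by_cases hlt : ∀ m, boxesUpToCol lam m ≤ boxesUpToCol mu m
  · have hgt : ¬ ∀ m, boxesUpToCol mu m ≤ boxesUpToCol lam m := fun hgt =>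
      h (eq_of_boxesUpToCol_eq fun m => le_antisymm (hlt m) (hgt m))
    simp_rw [mul_comm (chi lam _)]
    rw [sum_chi_mul_chi_eq_finrank, finrank_intertwiningMap_eq_zero hgt, Nat.cast_zero]
  · rw [sum_chi_mul_chi_eq_finrank, finrank_intertwiningMap_eq_zero hlt, Nat.cast_zero]

/-! ### The linear system -/

/-- The density of the conjugacy class labelled by `nu`. -/
def classDensity {n : ℕ} (nu : n.Partition) : ℂ :=
  (n.factorial : ℂ)⁻¹ * (Finset.univ.filter fun σ : Perm (Fin n) => cyclePartition σ = nu).card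

theorem sum_perm_eq_sum_partition {n : ℕ} (F : n.Partition → ℂ) :
    (n.factorial : ℂ)⁻¹ * ∑ σ : Perm (Fin n), F (cyclePartition σ)
      = ∑ nu, classDensity nu * F nu := by
  rw [← Finset.sum_fiberwise_of_maps_to (g := cyclePartition) (t := Finset.univ)
    (fun _ _ => Finset.mem_univ _), Finset.mul_sum]
  refine Finset.sum_congr rfl fun nu _ => ?_
  rw [Finset.sum_congr rfl (g := fun _ => F nu) fun σ hσ => by rw [(Finset.mem_filter.1 hσ).2],
    Finset.sum_const, nsmul_eq_mul, classDensity, mul_assoc]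

theorem charTable_mul_classDensity_mul_transpose (n : ℕ) :
    charTable n * (Matrix.diagonal classDensity * (charTable n)ᵀ) = 1 := by
  ext lam mu
  rw [Matrix.one_apply, ← chi_orthonormal, Matrix.mul_apply]
  simp_rw [Matrix.diagonal_mul, Matrix.transpose_apply]
  have h := sum_perm_eq_sum_partition fun nu => charTable n lam nu * charTable n mu nu
  simp_rw [charTable_cyclePartition] at h
  rw [h]
  exact Finset.sum_congr rfl fun nu _ => by ring

theorem det_charTable_ne_zero (n : ℕ) : (charTable n).det ≠ 0 := by
  have h := congrArg Matrix.det (charTable_mul_classDensity_mul_transpose n)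
  rw [Matrix.det_mul, Matrix.det_one] at h
  exact left_ne_zero_of_mul_eq_one h

theorem numCycles_eq_card_parts {n : ℕ} (σ : Perm (Fin n)) :
    numCycles σ = Multiset.card (cyclePartition σ).parts := by
  change _ = Multiset.card σ.partition.parts
  rw [Perm.parts_partition, Multiset.card_add, Multiset.card_replicate, numCycles,
    Perm.card_fixedPoints, Perm.sum_cycleType]

theorem coeff_eq_mulVec {n : ℕ} (α : ℂ) :
    (fun lam => coeff lam α) = charTable n *ᵥ (Matrix.diagonal classDensity *ᵥ powVec n α) := by
  ext lam
  have h := sum_perm_eq_sum_partition fun nu => powVec n α nu * charTable n lam nu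
  simp_rw [charTable_cyclePartition, powVec, ← numCycles_eq_card_parts] at h
  rw [coeff, one_div, h, Matrix.mulVec, dotProduct]
  exact Finset.sum_congr rfl fun nu _ => by rw [Matrix.mulVec_diagonal, powVec]; ring

theorem powVec_eq_transpose_mulVec_coeff (n : ℕ) (α : ℂ) :
    powVec n α = (charTable n)ᵀ *ᵥ fun lam => coeff lam α := by
  have h := charTable_mul_classDensity_mul_transpose n
  -- For square matrices a one-sided inverse is two-sided: row orthogonality becomes column
  -- orthogonality.
  rw [← mul_assoc, mul_eq_one_comm] at h
  rw [coeff_eq_mulVec, Matrix.mulVec_mulVec, Matrix.mulVec_mulVec, mul_assoc, h, Matrix.one_mulVec]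

theorem alphaPermanent_eq_sum_coeff_mul_immanant {n : ℕ} (α : ℂ) (M : Matrix (Fin n) (Fin n) ℂ) :
    alphaPermanent α M = ∑ lam : n.Partition, coeff lam α * immanant lam M := by
  simp_rw [alphaPermanent, immanant, Finset.mul_sum]
  rw [Finset.sum_comm]
  refine Finset.sum_congr rfl fun σ _ => ?_
  have h := congrFun (powVec_eq_transpose_mulVec_coeff n α) (cyclePartition σ)
  rw [powVec, ← numCycles_eq_card_parts] at h
  rw [h, Matrix.mulVec, dotProduct, Finset.sum_mul]
  refine Finset.sum_congr rfl fun lam _ => ?_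
  rw [Matrix.transpose_apply, charTable_cyclePartition]
  ring

theorem minorMatrix_eq_transpose_adjugate {ι : Type*} [Fintype ι] [DecidableEq ι] {m : ℕ}
    (e : ι ≃ Fin (m + 1)) (B : Matrix ι ι ℂ) : minorMatrix e B = B.adjugateᵀ := by
  ext i j
  -- The indices are swapped because the `(e j, e i)` entry of the adjugate deletes row `e i` and
  -- column `e j`.
  have h := congrFun (congrFun (Matrix.adjugate_reindex e B) (e j)) (e i)
  rw [Matrix.adjugate_fin_succ_eq_det_submatrix] at h
  simp only [Matrix.reindex_apply, Matrix.submatrix_apply, symm_apply_apply] at h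
  rw [Matrix.transpose_apply, ← h, minorMatrix, Matrix.of_apply, minorDet]
  rfl

end AlphaPerm

end

theorem mainTheorem5 (n : ℕ) :
    (∀ (α : ℂ) (M : Matrix (Fin n) (Fin n) ℂ),
      AlphaPerm.alphaPermanent α M
        = ∑ lam : n.Partition, AlphaPerm.coeff lam α * AlphaPerm.immanant lam M) ∧
    (∀ α : ℂ,
      AlphaPerm.powVec n α
        = (AlphaPerm.charTable n)ᵀ *ᵥ (fun lam => AlphaPerm.coeff lam α)) ∧
    (AlphaPerm.charTable n).det ≠ 0 ∧
    (∀ (α : ℂ) (v : n.Partition → ℂ),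
      AlphaPerm.powVec n α = (AlphaPerm.charTable n)ᵀ *ᵥ v →
        v = fun lam => AlphaPerm.coeff lam α) ∧
    (∀ (m : ℕ) (e : n.Partition ≃ Fin (m + 1)) (α : ℂ),
      (fun lam => AlphaPerm.coeff lam α)
        = ((AlphaPerm.charTable n).det)⁻¹ •
            (AlphaPerm.minorMatrix e (AlphaPerm.charTable n) *ᵥ AlphaPerm.powVec n α)) := by
  have hdet := AlphaPerm.det_charTable_ne_zero n
  refine ⟨AlphaPerm.alphaPermanent_eq_sum_coeff_mul_immanant,
    AlphaPerm.powVec_eq_transpose_mulVec_coeff n, hdet, fun α v hv => ?_, fun m e α => ?_⟩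
  · refine Matrix.mulVec_injective_of_isUnit ?_
      (hv.symm.trans (AlphaPerm.powVec_eq_transpose_mulVec_coeff n α))
    rw [Matrix.isUnit_iff_isUnit_det, Matrix.det_transpose]
    exact hdet.isUnit
  -- With `A = Xᵀ c`, the product becomes `adj(Xᵀ) Xᵀ c = det X • c`.
  · rw [AlphaPerm.minorMatrix_eq_transpose_adjugate, Matrix.adjugate_transpose,
      AlphaPerm.powVec_eq_transpose_mulVec_coeff, Matrix.mulVec_mulVec, Matrix.adjugate_mul,
      Matrix.det_transpose, Matrix.smul_mulVec, Matrix.one_mulVec, inv_smul_smul₀ hdet]
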